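/- Conventions. An operator system is a closed self-adjoint subspace, containing the unit, of a unital C*-algebra; all completely positive maps are unital. A groupoid $\mathcal G$ with unit space $\mathcal G^{(0)}$, source map $s$ and range map $r$ is understood algebraically (no topology). A groupoid dynamical system $\mathcal A=(\mathcal G,\{A_u\}_{u\in\mathcal G^{(0)}},\alpha)$ consists of operator systems $A_u$ and unital complete order isomorphisms $\alpha_g:A_{s(g)}\to A_{r(g)}$, $g\in\mathcal G$, with $\alpha_g\alpha_h=\alpha_{gh}$ whenever $s(g)=r(h)$. A $\mathcal G$-morphism $\mathcal A\to\mathcal B=(\mathcal G,\{B_u\},\beta)$ is a family of unital completely positive maps $\varphi_u:A_u\to B_u$ with $\beta_g\circ\varphi_{s(g)}=\varphi_{r(g)}\circ\alpha_g$ for all $g$; it is a $\mathcal G$-embedding if each $\varphi_u$ is a complete order embedding (a matrix over $A_u$ is positive if and only if its image is). The system $\mathcal W$ is $\mathcal G$-injective if for every $\mathcal G$-embedding $\Phi:\mathcal A\to\mathcal B$ and every $\mathcal G$-morphism $\Psi:\mathcal A\to\mathcal W$ there is a $\mathcal G$-morphism $\Theta:\mathcal B\to\mathcal W$ with $\Theta\circ\Phi=\Psi$.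 An operator system (in particular a unital C*-algebra) $W$ is injective if unital completely positive maps $S\to W$ extend along every complete order embedding of operator systems $S\to T$. Theorem. Let $\mathcal A=(\mathcal G,\{A_u\}_{u\in\mathcal G^{(0)}},\alpha)$ be a $\mathcal G$-injective groupoid dynamical system. Each $A_u$ carries a unique multiplication making it a C*-algebra with its given involution, unit, norm and matrix order, and with respect to these multiplications every $\alpha_g$ is a $*$-isomorphism. The fixed point algebra $$\mathcal A^{(\alpha)}=\Big\{f\in\prod_{u\in\mathcal G^{(0)}}A_u:\ \sup_u\|f(u)\|<\infty,\ f(r(g))=\alpha_g(f(s(g)))\text{ for all } g\in\mathcal G\Big\},$$ with pointwise operations and the supremum norm, is then an injective C*-algebra. -/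

import Mathlib

open scoped ENNReal Matrix ComplexOrder
open CategoryTheory

universe u v w

noncomputable section

/-! ### Operator systems and unital completely positive maps -/

/-- Positivity in the C⋆-algebra `M_n(B)` over a unital C⋆-algebra `B`: being of the form `N⋆ N`. -/
def MatrixPos {B : Type*} [CStarAlgebra B] {n : ℕ} (M : Matrix (Fin n) (Fin n) B) : Prop :=
  ∃ N : Matrix (Fin n) (Fin n) B, M = Nᴴ * N

/-- A (concrete) operator system: a closed, self-adjoint subspace of a unital C⋆-algebra which
contains the unit. The zero algebra is allowed. -/
structure OperatorSystem where
  /-- the surrounding unital C⋆-algebra -/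
  ambient : Type w
  [cstarAlgebra : CStarAlgebra ambient]
  /-- the subspace -/
  space : Submodule ℂ ambient
  one_mem : (1 : ambient) ∈ space
  star_mem : ∀ x ∈ space, star x ∈ space
  isClosed : IsClosed (space : Set ambient)

attribute [instance] OperatorSystem.cstarAlgebra

namespace OperatorSystem

instance : CoeSort OperatorSystem.{w} (Type w) := ⟨fun S => S.space⟩

/-- The unit of an operator system. -/
def unit (S : OperatorSystem.{w}) : S := ⟨1, S.one_mem⟩

/-- A matrix over an operator system is positive if it is positive as a matrix over the
surrounding C⋆-algebra. -/
def Pos (S : OperatorSystem.{w}) {n : ℕ} (M : Matrix (Fin n) (Fin n) S) : Prop :=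
  MatrixPos (M.map (fun x : S => (x : S.ambient)))

/-- A unital C⋆-algebra, seen as an operator system. -/
abbrev ofCStarAlgebra (M : Type w) [CStarAlgebra M] : OperatorSystem.{w} where
  ambient := M
  space := ⊤
  one_mem := trivial
  star_mem := fun _ _ => trivial
  isClosed := isClosed_univ

end OperatorSystem

/-- A unital completely positive map between operator systems. -/
structure UCPMap (S T : OperatorSystem.{w}) where
  /-- the underlying linear map -/
  toLinearMap : S →ₗ[ℂ] T
  map_unit : toLinearMap S.unit = T.unit
  map_pos : ∀ (n : ℕ) (M : Matrix (Fin n) (Fin n) S), S.Pos M → T.Pos (M.map toLinearMap)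

namespace UCPMap

variable {S T : OperatorSystem.{w}}

instance : CoeFun (UCPMap S T) (fun _ => S → T) := ⟨fun φ => φ.toLinearMap⟩

/-- A (unital) complete order embedding: a matrix over `S` is positive as soon as its image is.
Such a map is automatically injective, even completely isometric. -/
def IsCompleteOrderEmbedding (φ : UCPMap S T) : Prop :=
  ∀ (n : ℕ) (M : Matrix (Fin n) (Fin n) S), T.Pos (M.map φ) → S.Pos M

/-- A (unital) complete order isomorphism: a bijection which is completely positive in both
directions. -/
def IsCompleteOrderIso (φ : UCPMap S T) : Prop :=
  Function.Bijective φ ∧ φ.IsCompleteOrderEmbedding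

/-! Unital completely positive maps are bounded. -/

theorem matrixPos_one {B : Type*} [CStarAlgebra B] (b : B) :
    MatrixPos (fun _ _ : Fin 1 => b) ↔ ∃ c : B, b = star c * c := by
  constructor
  · rintro ⟨N, hN⟩
    refine ⟨N 0 0, ?_⟩
    have := congrFun (congrFun hN 0) 0
    simpa [Matrix.mul_apply] using this
  · rintro ⟨c, rfl⟩
    refine ⟨fun _ _ => c, ?_⟩
    ext i j
    change star c * c = ∑ k : Fin 1, star c * c
    simp

theorem map_pos_one (φ : UCPMap S T) (x : S) (h : ∃ c : S.ambient, (x : S.ambient) = star c * c) :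
    ∃ c : T.ambient, (φ x : T.ambient) = star c * c :=
  (matrixPos_one _).1 (φ.map_pos 1 (fun _ _ => x) ((matrixPos_one _).2 h))

theorem norm_one_le (B : Type*) [CStarAlgebra B] : ‖(1 : B)‖ ≤ 1 := by
  rcases subsingleton_or_nontrivial B with h | h
  · simp [Subsingleton.elim (1 : B) 0]
  · simp

theorem map_selfAdjoint (φ : UCPMap S T) (x : S) (hx : IsSelfAdjoint (x : S.ambient)) :
    IsSelfAdjoint (φ x : T.ambient) := by
  let _ := CStarAlgebra.spectralOrder S.ambient
  have := CStarAlgebra.spectralOrderedRing S.ambient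
  set c : ℝ := ‖x‖
  obtain ⟨b, hb⟩ := φ.map_pos_one ((c : ℂ) • S.unit - x)
    (by
      obtain ⟨b, hb⟩ := CStarAlgebra.nonneg_iff_eq_star_mul_self.1
        (sub_nonneg.2 hx.le_algebraMap_norm_self)
      refine ⟨b, ?_⟩
      rw [← hb]
      simp [OperatorSystem.unit, Algebra.algebraMap_eq_smul_one, c])
  rw [map_sub, map_smul, φ.map_unit] at hb
  have : (φ x : T.ambient) = (c : ℂ) • (1 : T.ambient) - star b * b := by
    rw [← hb]
    simp [OperatorSystem.unit]
  rw [this]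
  refine IsSelfAdjoint.sub ?_ (IsSelfAdjoint.star_mul_self b)
  simp [IsSelfAdjoint]

theorem map_star_eq (φ : UCPMap S T) (x : S) :
    (φ ⟨star (x : S.ambient), S.star_mem _ x.2⟩ : T.ambient) = star (φ x : T.ambient) := by
  let y : S := ⟨star (x : S.ambient), S.star_mem _ x.2⟩
  have ha : IsSelfAdjoint ((x + y : S) : S.ambient) := by
    simp [y, IsSelfAdjoint, add_comm]
  have hb : IsSelfAdjoint ((Complex.I • (x - y) : S) : S.ambient) := by
    simp [y, IsSelfAdjoint, add_comm, sub_eq_add_neg]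
  have h1 := (φ.map_selfAdjoint _ ha).star_eq
  have h2 := (φ.map_selfAdjoint _ hb).star_eq
  rw [map_add] at h1
  rw [map_smul, map_sub] at h2
  simp only [Submodule.coe_add, Submodule.coe_smul, Submodule.coe_sub, star_add, star_smul,
    star_sub, Complex.star_def, Complex.conj_I, neg_smul] at h1 h2
  have h3 : star (φ x : T.ambient) - star (φ y : T.ambient) = -((φ x : T.ambient) - φ y) := by
    have := congrArg (fun z => Complex.I • z) h2
    simpa [smul_neg, smul_smul, Complex.I_mul_I] using this
  change (φ y : T.ambient) = star (φ x : T.ambient)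
  have h4 : (2 : ℂ) • star (φ x : T.ambient) = (2 : ℂ) • (φ y : T.ambient) := by
    calc (2 : ℂ) • star (φ x : T.ambient)
        = (star (φ x : T.ambient) + star (φ y : T.ambient))
          + (star (φ x : T.ambient) - star (φ y : T.ambient)) := by module
      _ = _ := by rw [h1, h3]; module
  exact ((smul_right_injective _ (two_ne_zero : (2 : ℂ) ≠ 0)) h4).symm

theorem norm_map_le_of_selfAdjoint (φ : UCPMap S T) (x : S)
    (hx : IsSelfAdjoint (x : S.ambient)) : ‖φ x‖ ≤ 3 * ‖x‖ := by
  let _ := CStarAlgebra.spectralOrder S.ambient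
  have := CStarAlgebra.spectralOrderedRing S.ambient
  let _ := CStarAlgebra.spectralOrder T.ambient
  have := CStarAlgebra.spectralOrderedRing T.ambient
  set c : ℝ := ‖x‖ with hc
  have key : ∀ y : S, (y : S.ambient) ≤ algebraMap ℝ S.ambient c →
      (φ y : T.ambient) ≤ algebraMap ℝ T.ambient c := by
    intro y hy
    obtain ⟨b, hb⟩ := φ.map_pos_one ((c : ℂ) • S.unit - y)
      (by
        obtain ⟨b, hb⟩ := CStarAlgebra.nonneg_iff_eq_star_mul_self.1 (sub_nonneg.2 hy)
        refine ⟨b, ?_⟩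
        rw [← hb]
        simp [OperatorSystem.unit, Algebra.algebraMap_eq_smul_one])
    rw [← sub_nonneg]
    refine CStarAlgebra.nonneg_iff_eq_star_mul_self.2 ⟨b, ?_⟩
    rw [← hb, map_sub, map_smul, φ.map_unit]
    simp [OperatorSystem.unit, Algebra.algebraMap_eq_smul_one]
  have h1 := key x hx.le_algebraMap_norm_self
  have h2 := key (-x) (by
    have := hx.neg_algebraMap_norm_le_self
    exact neg_le.1 this)
  have hc0 : 0 ≤ c := norm_nonneg _
  set p : T.ambient := algebraMap ℝ T.ambient c - (φ x : T.ambient) with hp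
  have hp0 : 0 ≤ p := sub_nonneg.2 h1
  have hp2 : p ≤ algebraMap ℝ T.ambient (2 * c) := by
    have : -(φ x : T.ambient) ≤ algebraMap ℝ T.ambient c := by simpa using h2
    rw [two_mul, map_add, hp, sub_eq_add_neg]
    exact add_le_add le_rfl this
  have hpn : ‖p‖ ≤ 2 * c := (CStarAlgebra.norm_le_iff_le_algebraMap p (by positivity) hp0).2 hp2
  have hcn : ‖algebraMap ℝ T.ambient c‖ ≤ c := by
    rw [Algebra.algebraMap_eq_smul_one, norm_smul, Real.norm_of_nonneg hc0]
    exact mul_le_of_le_one_right hc0 (norm_one_le _)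
  have : (φ x : T.ambient) = algebraMap ℝ T.ambient c - p := by simp [hp]
  calc ‖φ x‖ = ‖algebraMap ℝ T.ambient c - p‖ := by rw [← this]; rfl
    _ ≤ ‖algebraMap ℝ T.ambient c‖ + ‖p‖ := norm_sub_le _ _
    _ ≤ 3 * c := by linarith

theorem norm_map_le (φ : UCPMap S T) (x : S) : ‖φ x‖ ≤ 6 * ‖x‖ := by
  let y : S := ⟨star (x : S.ambient), S.star_mem _ x.2⟩
  have hy : ‖y‖ = ‖x‖ := norm_star (x : S.ambient)
  let a : S := x + y
  let b : S := Complex.I • (x - y)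
  have ha : IsSelfAdjoint (a : S.ambient) := by
    simp [a, y, IsSelfAdjoint, add_comm]
  have hb : IsSelfAdjoint (b : S.ambient) := by
    simp [b, y, IsSelfAdjoint, smul_sub, add_comm, sub_eq_add_neg]
  have hab : (2 : ℂ) • x = a - Complex.I • b := by
    simp only [a, b, smul_smul, Complex.I_mul_I, two_smul]
    module
  have h1 := φ.norm_map_le_of_selfAdjoint a ha
  have h2 := φ.norm_map_le_of_selfAdjoint b hb
  have h3 : ‖a‖ ≤ 2 * ‖x‖ := (norm_add_le _ _).trans (by rw [hy, two_mul])
  have h4 : ‖b‖ ≤ 2 * ‖x‖ := by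
    simp only [b, norm_smul, Complex.norm_I, one_mul]
    exact (norm_sub_le _ _).trans (by rw [hy, two_mul])
  have h5 : (2 : ℂ) • φ x = φ a - Complex.I • φ b := by
    rw [← map_smul, hab, map_sub, map_smul]
  have h6 : 2 * ‖φ x‖ ≤ ‖φ a‖ + ‖φ b‖ := by
    calc 2 * ‖φ x‖ = ‖(2 : ℂ) • φ x‖ := by simp [norm_smul]
      _ ≤ ‖φ a‖ + ‖Complex.I • φ b‖ := by rw [h5]; exact norm_sub_le _ _
      _ = _ := by simp [norm_smul]
  linarith

theorem continuous (φ : UCPMap S T) : Continuous φ :=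
  AddMonoidHomClass.continuous_of_bound φ.toLinearMap 6 φ.norm_map_le

end UCPMap

namespace OperatorSystem

/-- Injectivity of an operator system: unital completely positive maps into it extend along
complete order embeddings. -/
def IsInjective (W : OperatorSystem.{w}) : Prop :=
  ∀ (S T : OperatorSystem.{w}) (φ : UCPMap S T), φ.IsCompleteOrderEmbedding →
    ∀ ψ : UCPMap S W, ∃ θ : UCPMap T W, ∀ x, θ (φ x) = ψ x

/-- `mul` makes the operator system `S`, with its given involution, unit, norm and matrix order,
a C⋆-algebra: there is a C⋆-algebra `M` and a unital complete order isomorphism of `S` with `M`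
which turns `mul` into the multiplication of `M`. (Such isomorphisms preserve the involution
and the norm.) -/
def IsCStarProduct (S : OperatorSystem.{w}) (mul : S → S → S) : Prop :=
  ∃ (M : Type w) (_ : CStarAlgebra M) (e : UCPMap S (ofCStarAlgebra M)),
    e.IsCompleteOrderIso ∧ ∀ x y, (e (mul x y) : M) = (e x : M) * (e y : M)

end OperatorSystem

/-! ### Bounded sections -/

section BoundedSections

variable {ι : Type u}

/-- The `ℓ^∞`-direct sum of unital C⋆-algebras is a unital C⋆-algebra (also if some of the
summands vanish). -/
@[reducible]
def linftyCStarAlgebra (B : ι → Type w) [∀ i, CStarAlgebra (B i)] :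
    CStarAlgebra (lp B ∞) :=
  letI : One (lp B ∞) :=
    ⟨⟨fun _ => 1, memℓp_infty ⟨1, by rintro _ ⟨i, rfl⟩; exact UCPMap.norm_one_le (B i)⟩⟩⟩
  letI : NormedRing (lp B ∞) :=
    { lp.nonUnitalNormedRing with
      one_mul := fun f => lp.ext (funext fun i => one_mul (f i))
      mul_one := fun f => lp.ext (funext fun i => mul_one (f i)) }
  letI : NormedAlgebra ℂ (lp B ∞) :=
    { Algebra.ofModule (fun r f g => smul_mul_assoc r f g) (fun r f g => mul_smul_comm r f g) with
      norm_smul_le := norm_smul_le }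
  { (inferInstance : NormedRing (lp B ∞)), (inferInstance : NormedAlgebra ℂ (lp B ∞)),
    (inferInstance : NonUnitalCStarAlgebra (lp B ∞)) with }

/-- The operator system `Γ_∞(ι, A)` of bounded sections of a family of operator systems. -/
def boundedSections (A : ι → OperatorSystem.{w}) : OperatorSystem.{max u w} :=
  letI := linftyCStarAlgebra (fun i => (A i).ambient)
  { ambient := lp (fun i => (A i).ambient) ∞
    space :=
      { carrier := {f | ∀ i, f i ∈ (A i).space}
        zero_mem' := fun i => (A i).space.zero_mem
        add_mem' := fun hf hg i => (A i).space.add_mem (hf i) (hg i)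
        smul_mem' := fun c f hf i => (A i).space.smul_mem c (hf i) }
    one_mem := fun i => (A i).one_mem
    star_mem := fun f hf i => (A i).star_mem _ (hf i)
    isClosed := by
      change IsClosed {f : lp (fun i => (A i).ambient) ∞ | ∀ i, f i ∈ (A i).space}
      simp only [Set.ofPred_forall]
      refine isClosed_iInter fun i => (A i).isClosed.preimage ?_
      exact (lp.lipschitzWith_one_eval ∞ i).continuous }

/-- The value at `i` of a bounded section. -/
def boundedSections.eval {A : ι → OperatorSystem.{w}} (f : boundedSections A) (i : ι) : A i :=
  ⟨(show lp (fun i => (A i).ambient) ∞ from f.1) i, f.2 i⟩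

theorem boundedSections.continuous_eval {A : ι → OperatorSystem.{w}} (i : ι) :
    Continuous (fun f : boundedSections A => boundedSections.eval f i) :=
  Continuous.subtype_mk ((lp.lipschitzWith_one_eval ∞ i).continuous.comp
    (continuous_subtype_val :
      Continuous (fun f : boundedSections A => (f : (boundedSections A).ambient)))) _

end BoundedSections

/-! ### Groupoid dynamical systems -/

/-- A dynamical system over a groupoid with unit space `G₀`: operator systems `A_u`, `u : G₀`, and
unital complete order isomorphisms `α_g : A_{d(g)} → A_{r(g)}` with `α_g α_h = α_{gh}` for
composable `g`, `h`. An arrow `g : x ⟶ y` has source `d(g) = x` and range `r(g) = y`, and the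
groupoid product `gh` is `h ≫ g`. -/
structure GroupoidDynamicalSystem (G₀ : Type u) [Groupoid.{v} G₀] where
  /-- the operator systems `A_u` -/
  fiber : G₀ → OperatorSystem.{w}
  /-- the maps `α_g` -/
  action : ∀ {x y : G₀}, (x ⟶ y) → UCPMap (fiber x) (fiber y)
  action_iso : ∀ {x y : G₀} (g : x ⟶ y), (action g).IsCompleteOrderIso
  action_comp : ∀ {x y z : G₀} (g : y ⟶ z) (h : x ⟶ y) (a : fiber x),
    action g (action h a) = action (h ≫ g) a

namespace GroupoidDynamicalSystem

variable {G₀ : Type u} [Groupoid.{v} G₀]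

/-- A `𝒢`-morphism: a family of unital completely positive maps intertwining the actions. -/
structure Morphism (𝒜 ℬ : GroupoidDynamicalSystem.{u, v, w} G₀) where
  /-- the maps between the fibres -/
  app : ∀ x : G₀, UCPMap (𝒜.fiber x) (ℬ.fiber x)
  equivariant : ∀ {x y : G₀} (g : x ⟶ y) (a : 𝒜.fiber x),
    ℬ.action g (app x a) = app y (𝒜.action g a)

/-- A `𝒢`-embedding: a `𝒢`-morphism consisting of complete order embeddings. -/
def Morphism.IsEmbedding {𝒜 ℬ : GroupoidDynamicalSystem.{u, v, w} G₀} (Φ : Morphism 𝒜 ℬ) : Prop :=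
  ∀ x, (Φ.app x).IsCompleteOrderEmbedding

/-- `𝒢`-injectivity: `𝒢`-morphisms into `𝒲` extend along `𝒢`-embeddings. -/
def IsInjective (𝒲 : GroupoidDynamicalSystem.{u, v, w} G₀) : Prop :=
  ∀ (𝒜 ℬ : GroupoidDynamicalSystem.{u, v, w} G₀) (Φ : Morphism 𝒜 ℬ), Φ.IsEmbedding →
    ∀ Ψ : Morphism 𝒜 𝒲, ∃ Θ : Morphism ℬ 𝒲, ∀ x a, Θ.app x (Φ.app x a) = Ψ.app x a

/-- The operator system `𝒜^(α)` of bounded sections `f` of `{A_u}` with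
`f(r(g)) = α_g(f(d(g)))` for all `g`. -/
def fixedPoints (𝒜 : GroupoidDynamicalSystem.{u, v, w} G₀) :
    OperatorSystem.{max u w} where
  ambient := (boundedSections 𝒜.fiber).ambient
  space :=
    { carrier := {f | ∃ hf : f ∈ (boundedSections 𝒜.fiber).space, ∀ (x y : G₀) (g : x ⟶ y),
        boundedSections.eval ⟨f, hf⟩ y = 𝒜.action g (boundedSections.eval ⟨f, hf⟩ x)}
      zero_mem' := ⟨Submodule.zero_mem _, fun x y g => (map_zero (𝒜.action g).toLinearMap).symm⟩
      add_mem' := by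
        rintro f₁ f₂ ⟨k₁, h₁⟩ ⟨k₂, h₂⟩
        refine ⟨Submodule.add_mem _ k₁ k₂, fun x y g => ?_⟩
        refine Eq.trans ?_ (map_add (𝒜.action g).toLinearMap
          (boundedSections.eval ⟨f₁, k₁⟩ x) (boundedSections.eval ⟨f₂, k₂⟩ x)).symm
        rw [← h₁ x y g, ← h₂ x y g]
        rfl
      smul_mem' := by
        rintro c f ⟨k, h⟩
        refine ⟨Submodule.smul_mem _ c k, fun x y g => ?_⟩
        refine Eq.trans ?_ (map_smul (𝒜.action g).toLinearMap c
          (boundedSections.eval ⟨f, k⟩ x)).symm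
        rw [← h x y g]
        rfl }
  one_mem := ⟨(boundedSections 𝒜.fiber).one_mem, fun x y g => (𝒜.action g).map_unit.symm⟩
  star_mem := by
    rintro f ⟨k, h⟩
    refine ⟨(boundedSections 𝒜.fiber).star_mem f k, fun x y g => Subtype.ext ?_⟩
    refine Eq.trans ?_ ((𝒜.action g).map_star_eq (boundedSections.eval ⟨f, k⟩ x)).symm
    rw [← h x y g]
    rfl
  isClosed := by
    have h1 : IsClosed {f : boundedSections 𝒜.fiber | ∀ (x y : G₀) (g : x ⟶ y),
        boundedSections.eval f y = 𝒜.action g (boundedSections.eval f x)} := by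
      simp only [Set.ofPred_forall]
      exact isClosed_iInter fun x => isClosed_iInter fun y => isClosed_iInter fun g =>
        isClosed_eq (boundedSections.continuous_eval y)
          ((𝒜.action g).continuous.comp (boundedSections.continuous_eval x))
    convert (boundedSections 𝒜.fiber).isClosed.isClosedEmbedding_subtypeVal.isClosedMap _ h1 using 1
    ext f
    constructor
    · rintro ⟨k, h⟩
      exact ⟨⟨f, k⟩, h, rfl⟩
    · rintro ⟨⟨f, k⟩, h, rfl⟩
      exact ⟨k, h⟩

/-- The value at `x` of an element of `𝒜^(α)`. -/
def fixedPoints.eval {𝒜 : GroupoidDynamicalSystem.{u, v, w} G₀} (f : 𝒜.fixedPoints)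
    (x : G₀) : 𝒜.fiber x :=
  boundedSections.eval ⟨(f.1 : (boundedSections 𝒜.fiber).ambient), f.2.choose⟩ x

end GroupoidDynamicalSystem

end

/-!
The proof rests on two facts about unital completely positive maps between C⋆-algebras, both read
off from the matrix Schwarz inequality `IsUCP.defect_pos`: for `x₀ = 1` the matrix with entries
`φ(xᵢ⋆ xⱼ) - φ(xᵢ)⋆ φ(xⱼ)` is positive, and a positive matrix with a vanishing diagonal entry has
vanishing row.

* A unital complete order isomorphism of C⋆-algebras is multiplicative
  (`IsUCP.map_mul_of_leftInverse`). Hence the multiplication of an operator system is unique, if it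
  exists, and is respected by complete order isomorphisms such as the `α_g`.
* The Choi–Effros theorem: if `φ` is an idempotent unital completely positive map on a C⋆-algebra
  `B`, then its range is a C⋆-algebra under `x ∘ y = φ(x y)`, with the norm and matrix order of `B`
  (`UCPProjection.matrixPos_iff`). So an operator system that is a retract of a C⋆-algebra is a
  C⋆-algebra (`OperatorSystem.isCStarProduct_of_retract`).

No injective envelope and no representation on a Hilbert space is needed. The system `𝒜` embeds
equivariantly, through the orbit maps `a ↦ (g ↦ α_g(a))`, into the groupoid acting by translation on
the C⋆-algebras of bounded functions on the arrows out of a unit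
(`GroupoidDynamicalSystem.toRegular`). If `𝒜` is injective, then the identity of `𝒜` extends along
this embedding, and every fibre is a retract of a C⋆-algebra.

A unital completely positive map `S → 𝒜^(α)` is the same as a morphism to `𝒜` from the constant
system `S` with trivial action, so `𝒜^(α)` inherits injectivity from `𝒜`. In particular it is a
retract of the `ℓ^∞`-direct sum of the fibres; as it is closed under the pointwise product there,
its Choi–Effros product is the pointwise one.
-/

noncomputable section

/-! ### Positive matrices over a C⋆-algebra -/

/-- A self-adjoint element `h` is positive as soon as some notion of positivity `P`, under which
only zero is both positive and negative, holds for all elements `k⋆ k` and all compressions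
`k⋆ h k`. The negative part `n` of `h` gives `n h n = -n³`, so that both `n³` and `-n³` satisfy
`P`. -/
theorem exists_eq_star_mul_self_of_conjugates {D : Type*} [CStarAlgebra D] {h : D}
    (hh : IsSelfAdjoint h) (P : D → Prop)
    (hP : ∀ k, P (star k * k)) (hc : ∀ k, P (star k * h * k))
    (hz : ∀ d, P d → P (-d) → d = 0) : ∃ k, h = star k * k := by
  let _ := CStarAlgebra.spectralOrder D
  have := CStarAlgebra.spectralOrderedRing D
  have hn : 0 ≤ h⁻ := CFC.negPart_nonneg h
  have hns : star h⁻ = h⁻ := (IsSelfAdjoint.of_nonneg hn).star_eq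
  have h1 : P (h⁻ * h⁻ * h⁻) := by
    obtain ⟨k, hk⟩ := CStarAlgebra.nonneg_iff_eq_star_mul_self.1
      (star_left_conjugate_nonneg hn h⁻)
    rw [hns] at hk
    rw [hk]
    exact hP k
  have h2 : P (-(h⁻ * h⁻ * h⁻)) := by
    have := hc h⁻
    rw [hns] at this
    have e : h⁻ * h = -(h⁻ * h⁻) := by
      nth_rewrite 2 [← CFC.posPart_sub_negPart h hh]
      rw [mul_sub, CFC.negPart_mul_posPart, zero_sub]
    rwa [e, neg_mul] at this
  have h3 := hz _ h1 h2
  have h4 : star (h⁻ * h⁻) * (h⁻ * h⁻) = 0 := by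
    rw [star_mul, hns, ← mul_assoc, h3, zero_mul]
  rw [CStarRing.star_mul_self_eq_zero_iff] at h4
  have h5 : h⁻ = 0 := by
    rw [← CStarRing.star_mul_self_eq_zero_iff, hns, h4]
  exact CStarAlgebra.nonneg_iff_eq_star_mul_self.1 ((CFC.negPart_eq_zero_iff h hh).1 h5)

namespace MatrixPos

variable {B : Type*} [CStarAlgebra B] {n : ℕ} {M : Matrix (Fin n) (Fin n) B}

theorem conjTranspose_eq (hM : MatrixPos M) : Mᴴ = M := by
  obtain ⟨N, rfl⟩ := hM
  simp [Matrix.conjTranspose_mul]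

theorem conj (hM : MatrixPos M) (V : Matrix (Fin n) (Fin n) B) : MatrixPos (Vᴴ * M * V) := by
  obtain ⟨N, rfl⟩ := hM
  exact ⟨N * V, by simp [Matrix.conjTranspose_mul, mul_assoc]⟩

theorem diag_nonneg [PartialOrder B] [StarOrderedRing B] (hM : MatrixPos M) (i : Fin n) :
    0 ≤ M i i := by
  obtain ⟨N, rfl⟩ := hM
  rw [Matrix.mul_apply]
  exact Finset.sum_nonneg fun k _ => star_mul_self_nonneg (N k i)

theorem eq_zero_of_diag_eq_zero (hM : MatrixPos M) {i : Fin n} (hi : M i i = 0) (j : Fin n) :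
    M i j = 0 := by
  let _ := CStarAlgebra.spectralOrder B
  have := CStarAlgebra.spectralOrderedRing B
  obtain ⟨N, rfl⟩ := hM
  rw [Matrix.mul_apply] at hi ⊢
  have h := (Finset.sum_eq_zero_iff_of_nonneg
    (fun k _ => star_mul_self_nonneg (N k i))).1 hi
  refine Finset.sum_eq_zero fun k hk => ?_
  rw [Matrix.conjTranspose_apply, CStarRing.star_mul_self_eq_zero_iff _ |>.1 (h k hk)]
  simp

theorem eq_zero_of_neg (hM : MatrixPos M) (hM' : MatrixPos (-M)) : M = 0 := by
  let _ := CStarAlgebra.spectralOrder B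
  have := CStarAlgebra.spectralOrderedRing B
  ext i j
  refine hM.eq_zero_of_diag_eq_zero (le_antisymm ?_ (hM.diag_nonneg i)) j
  simpa using hM'.diag_nonneg i

/-- The Gram matrix of a family is positive. -/
theorem gram {n : ℕ} (x : Fin n → B) :
    MatrixPos (.of fun i j => star (x i) * x j) := by
  cases n with
  | zero => exact ⟨0, Subsingleton.elim _ _⟩
  | succ n =>
    refine ⟨.of fun k i => if k = 0 then x i else 0, ?_⟩
    ext i j
    simp [Matrix.mul_apply, Matrix.conjTranspose_apply]

/-- The matrix form of `exists_eq_star_mul_self_of_conjugates`, applied in the C⋆-algebra of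
matrices over `B`. -/
theorem of_conjugates {h : Matrix (Fin n) (Fin n) B} (hh : hᴴ = h)
    (P : Matrix (Fin n) (Fin n) B → Prop) (hP : ∀ k, P (kᴴ * k)) (hc : ∀ k, P (kᴴ * h * k))
    (hz : ∀ d, P d → P (-d) → d = 0) : MatrixPos h := by
  let _ := CStarAlgebra.spectralOrder B
  have := CStarAlgebra.spectralOrderedRing B
  obtain ⟨k, hk⟩ := exists_eq_star_mul_self_of_conjugates (D := CStarMatrix (Fin n) (Fin n) B)
    hh P hP hc hz
  exact ⟨CStarMatrix.ofMatrix.symm k, hk⟩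

end MatrixPos

/-! ### Unital completely positive maps between C⋆-algebras -/

/-- Unital complete positivity of a linear map between unital C⋆-algebras. -/
structure IsUCP {B C : Type*} [CStarAlgebra B] [CStarAlgebra C] (φ : B →ₗ[ℂ] C) : Prop where
  map_one : φ 1 = 1
  map_pos : ∀ {n : ℕ} {M : Matrix (Fin n) (Fin n) B}, MatrixPos M → MatrixPos (M.map φ)

namespace IsUCP

variable {B C : Type*} [CStarAlgebra B] [CStarAlgebra C] {φ : B →ₗ[ℂ] C}

theorem map_star (hφ : IsUCP φ) (a : B) : φ (star a) = star (φ a) := by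
  have h := congrFun (congrFun (hφ.map_pos (MatrixPos.gram ![1, a])).conjTranspose_eq 1) 0
  simpa [Matrix.conjTranspose_apply] using h.symm

/-- The matrix form of the Schwarz inequality. The Gram matrix of `1, x₁, …, xₙ` has positive image
under `φ`, and conjugating it so as to clear the first row and column leaves the Schur
complement. -/
theorem defect_pos (hφ : IsUCP φ) {n : ℕ} (x : Fin (n + 1) → B) (hx : x 0 = 1) :
    MatrixPos (.of fun i j => φ (star (x i) * x j) - star (φ (x i)) * φ (x j)) := by
  have h := (hφ.map_pos (MatrixPos.gram x)).conj
    (1 - .of fun k j => if k = 0 then φ (x j) else 0)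
  convert h
  ext i j
  set G : Matrix (Fin (n + 1)) (Fin (n + 1)) C :=
    Matrix.map (.of fun i j => star (x i) * x j) φ with hG
  set E : Matrix (Fin (n + 1)) (Fin (n + 1)) C :=
    .of fun k j => if k = 0 then φ (x j) else 0 with hE
  have hEl : ∀ (A : Matrix (Fin (n + 1)) (Fin (n + 1)) C) i j, (Eᴴ * A) i j
      = star (φ (x i)) * A 0 j := by
    intro A i j
    simp [Matrix.mul_apply, Matrix.conjTranspose_apply, hE, apply_ite star]
  have hEr : ∀ (A : Matrix (Fin (n + 1)) (Fin (n + 1)) C) i j, (A * E) i j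
      = A i 0 * φ (x j) := by
    intro A i j
    simp [Matrix.mul_apply, hE]
  rw [Matrix.conjTranspose_sub, Matrix.conjTranspose_one, sub_mul, mul_sub, mul_one, one_mul,
    sub_mul]
  simp only [Matrix.sub_apply, hEr, hEl]
  simp [hG, Matrix.map_apply, hx, hφ.map_star, hφ.map_one]

section Order

variable [PartialOrder C] [StarOrderedRing C]

theorem schwarz (hφ : IsUCP φ) (a : B) : star (φ a) * φ a ≤ φ (star a * a) :=
  sub_nonneg.1 ((hφ.defect_pos ![1, a] rfl).diag_nonneg 1)

theorem map_nonneg [PartialOrder B] [StarOrderedRing B] (hφ : IsUCP φ) {a : B} (ha : 0 ≤ a) :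
    0 ≤ φ a := by
  obtain ⟨c, rfl⟩ := CStarAlgebra.nonneg_iff_eq_star_mul_self.1 ha
  exact (star_mul_self_nonneg _).trans (hφ.schwarz c)

end Order

theorem norm_map_le (hφ : IsUCP φ) (a : B) : ‖φ a‖ ≤ ‖a‖ := by
  let _ := CStarAlgebra.spectralOrder B
  have := CStarAlgebra.spectralOrderedRing B
  let _ := CStarAlgebra.spectralOrder C
  have := CStarAlgebra.spectralOrderedRing C
  have h1 : φ (star a * a) ≤ algebraMap ℝ C (‖a‖ * ‖a‖) := by
    have h := hφ.map_nonneg (sub_nonneg.2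
      (CStarAlgebra.star_mul_le_algebraMap_norm_sq (a := a)))
    rw [map_sub, sub_nonneg] at h
    convert h using 1
    rw [Algebra.algebraMap_eq_smul_one, Algebra.algebraMap_eq_smul_one,
      LinearMap.map_smul_of_tower, hφ.map_one, sq]
  have h2 := (CStarAlgebra.norm_le_iff_le_algebraMap (star (φ a) * φ a) (by positivity)
    (star_mul_self_nonneg _)).2 ((hφ.schwarz a).trans h1)
  rw [CStarRing.norm_star_mul_self] at h2
  exact (mul_self_le_mul_self_iff (norm_nonneg _) (norm_nonneg _)).2 h2

/-- A unital completely positive map with a unital completely positive inverse is multiplicative: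
the two Schwarz inequalities make the defects `φ(a⋆ a) - φ(a)⋆ φ(a)` vanish, and these are diagonal
entries of a positive matrix. -/
theorem map_mul_of_leftInverse (hφ : IsUCP φ) {ψ : C →ₗ[ℂ] B} (hψ : IsUCP ψ)
    (hψφ : ∀ a, ψ (φ a) = a) (hφψ : ∀ c, φ (ψ c) = c) (a b : B) :
    φ (a * b) = φ a * φ b := by
  let _ := CStarAlgebra.spectralOrder B
  have := CStarAlgebra.spectralOrderedRing B
  let _ := CStarAlgebra.spectralOrder C
  have := CStarAlgebra.spectralOrderedRing C
  have hpos := hφ.defect_pos ![1, star a, b] rfl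
  have hdiag : φ (star (star a) * star a) - star (φ (star a)) * φ (star a) = 0 := by
    refine (Function.LeftInverse.injective hφψ) ?_
    rw [map_zero]
    refine le_antisymm ?_ (hψ.map_nonneg (sub_nonneg.2 (hφ.schwarz _)))
    rw [map_sub, hψφ, sub_nonpos]
    simpa only [hψφ] using hψ.schwarz (φ (star a))
  have h := hpos.eq_zero_of_diag_eq_zero (i := 1) hdiag 2
  simpa [hφ.map_star, sub_eq_zero] using h

/-- The key step of the Choi–Effros construction: an idempotent unital completely positive map kills
the products of its fixed points with the elements of its kernel. Applying `φ` to the positive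
defect matrix of `1, x, y` makes the diagonal entry at `x` vanish. -/
theorem map_star_mul_eq_zero {φ : B →ₗ[ℂ] B} (hφ : IsUCP φ) (hi : ∀ b, φ (φ b) = φ b) {x y : B}
    (hx : φ x = x) (hy : φ y = 0) : φ (star x * y) = 0 := by
  have hpos := hφ.map_pos (hφ.defect_pos ![1, x, y] rfl)
  have h := hpos.eq_zero_of_diag_eq_zero (i := 1) (by simp [hi, hx]) 2
  simpa [hi, hy] using h

theorem map_mul_map {φ : B →ₗ[ℂ] B} (hφ : IsUCP φ) (hi : ∀ b, φ (φ b) = φ b) {x : B}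
    (hx : φ x = x) (b : B) : φ (x * φ b) = φ (x * b) := by
  have h := hφ.map_star_mul_eq_zero hi (x := star x) (y := b - φ b)
    (by rw [hφ.map_star, hx]) (by rw [map_sub, hi, sub_self])
  rw [star_star, mul_sub, map_sub, sub_eq_zero] at h
  exact h.symm

theorem map_map_mul {φ : B →ₗ[ℂ] B} (hφ : IsUCP φ) (hi : ∀ b, φ (φ b) = φ b) {x : B}
    (hx : φ x = x) (b : B) : φ (φ b * x) = φ (b * x) := by
  have h := congrArg star (hφ.map_mul_map hi (x := star x) (by rw [hφ.map_star, hx]) (star b))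
  simpa [← hφ.map_star] using h

end IsUCP

/-! ### The Choi–Effros product -/

/-- An idempotent unital completely positive map on a unital C⋆-algebra. -/
structure UCPProjection (B : Type*) [CStarAlgebra B] where
  /-- the underlying linear map -/
  toLinearMap : B →ₗ[ℂ] B
  isUCP : IsUCP toLinearMap
  idem : ∀ b, toLinearMap (toLinearMap b) = toLinearMap b

namespace UCPProjection

variable {B : Type w} [CStarAlgebra B] (φ : UCPProjection B)

instance : CoeFun (UCPProjection B) (fun _ => B → B) := ⟨fun φ => φ.toLinearMap⟩

/-- The range of the projection, as the space of its fixed points. -/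
def range : Submodule ℂ B := LinearMap.eqLocus φ.toLinearMap LinearMap.id

variable {φ}

theorem map_coe (x : φ.range) : φ x = x := x.2

/-- The projection as a map onto its range. -/
def proj (φ : UCPProjection B) (b : B) : φ.range := ⟨φ b, φ.idem b⟩

/-- The Choi–Effros product `x ∘ y = φ(x y)`. -/
instance : Mul φ.range := ⟨fun x y => φ.proj (x * y)⟩

instance : One φ.range := ⟨⟨1, φ.isUCP.map_one⟩⟩

instance : Star φ.range :=
  ⟨fun x => ⟨star x, (φ.isUCP.map_star _).trans (congrArg star (map_coe x))⟩⟩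

theorem coe_mul (x y : φ.range) : ((x * y : φ.range) : B) = φ (x * y) := rfl

theorem coe_one : ((1 : φ.range) : B) = 1 := rfl

theorem coe_star (x : φ.range) : ((star x : φ.range) : B) = star (x : B) := rfl

instance : Ring φ.range :=
  { (inferInstance : AddCommGroup φ.range) with
    left_distrib := fun x y z => Subtype.ext <| by simp [coe_mul, mul_add]
    right_distrib := fun x y z => Subtype.ext <| by simp [coe_mul, add_mul]
    zero_mul := fun x => Subtype.ext <| by simp [coe_mul]
    mul_zero := fun x => Subtype.ext <| by simp [coe_mul]
    one_mul := fun x => Subtype.ext <| by simp [coe_mul, coe_one, map_coe]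
    mul_one := fun x => Subtype.ext <| by simp [coe_mul, coe_one, map_coe]
    mul_assoc := fun x y z => Subtype.ext <| by
      rw [coe_mul, coe_mul, coe_mul, coe_mul, φ.isUCP.map_map_mul φ.idem (map_coe z),
        φ.isUCP.map_mul_map φ.idem (map_coe x), mul_assoc] }

instance : NormedRing φ.range :=
  { (inferInstance : NormedAddCommGroup φ.range), (inferInstance : Ring φ.range) with
    norm_mul_le := fun x y => (φ.isUCP.norm_map_le _).trans (norm_mul_le (x : B) y) }

instance : StarRing φ.range where
  star_involutive x := Subtype.ext (star_star (x : B))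
  star_mul x y := Subtype.ext <| by
    simp only [coe_mul, coe_star, ← φ.isUCP.map_star, star_mul]
  star_add x y := Subtype.ext (star_add (x : B) y)

instance : CompleteSpace φ.range := by
  have hc : Continuous φ.toLinearMap :=
    AddMonoidHomClass.continuous_of_bound φ.toLinearMap 1
      fun x => by simpa using φ.isUCP.norm_map_le x
  have : IsClosed (φ.range : Set B) := isClosed_eq hc continuous_id
  exact this.completeSpace_coe

/-- The C⋆-identity is where the Schwarz inequality `x⋆ x ≤ φ(x⋆ x)` enters. -/
instance : CStarRing φ.range where
  norm_mul_self_le x := by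
    let _ := CStarAlgebra.spectralOrder B
    have := CStarAlgebra.spectralOrderedRing B
    have h := φ.isUCP.schwarz (x : B)
    rw [map_coe] at h
    have h2 := CStarAlgebra.norm_le_norm_of_nonneg_of_le (star_mul_self_nonneg _) h
    rw [CStarRing.norm_star_mul_self] at h2
    exact h2

instance : NormedAlgebra ℂ φ.range :=
  { Algebra.ofModule
      (fun r x y => Subtype.ext <| by simp [coe_mul])
      (fun r x y => Subtype.ext <| by simp [coe_mul]) with
    norm_smul_le := norm_smul_le }

/-- The range of an idempotent unital completely positive map is a C⋆-algebra under the Choi–Effros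
product. -/
instance : CStarAlgebra φ.range where
  star_smul r x := Subtype.ext (star_smul r (x : B))

theorem coe_matrix_mul {n : ℕ} (M N : Matrix (Fin n) (Fin n) φ.range) :
    (M * N).map ((↑) : φ.range → B) =
      (M.map ((↑) : φ.range → B) * N.map ((↑) : φ.range → B)).map φ := by
  ext i j
  simp only [Matrix.map_apply, Matrix.mul_apply, map_sum]
  rw [AddSubmonoidClass.coe_finsetSum]
  rfl

/-- A matrix over the range is positive for the Choi–Effros product if and only if it is positive
over the surrounding algebra. In one direction `k⋆ ∘ k = φ(k⋆ k)`; in the other, a positive `M`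
has compressions `k⋆ ∘ M ∘ k = φ(k⋆ M k)`, and `MatrixPos.of_conjugates` applies. -/
theorem matrixPos_iff {n : ℕ} (M : Matrix (Fin n) (Fin n) φ.range) :
    MatrixPos M ↔ MatrixPos (M.map ((↑) : φ.range → B)) := by
  have hstar : ∀ k : Matrix (Fin n) (Fin n) φ.range,
      kᴴ.map ((↑) : φ.range → B) = (k.map ((↑) : φ.range → B))ᴴ := fun k => by
    ext i j; simp [coe_star]
  have hinj : Function.Injective fun k : Matrix (Fin n) (Fin n) φ.range =>
      k.map ((↑) : φ.range → B) := Matrix.map_injective Subtype.val_injective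
  have hsq : ∀ k : Matrix (Fin n) (Fin n) φ.range,
      MatrixPos ((kᴴ * k).map ((↑) : φ.range → B)) := fun k => by
    rw [coe_matrix_mul, hstar]
    exact φ.isUCP.map_pos ⟨_, rfl⟩
  refine ⟨fun ⟨N, hN⟩ => hN ▸ hsq N, fun h => ?_⟩
  refine MatrixPos.of_conjugates (hinj ?_) (fun k => MatrixPos (k.map ((↑) : φ.range → B)))
    hsq (fun k => ?_) fun d h1 h2 => hinj ?_
  · dsimp only
    rw [hstar, h.conjTranspose_eq]
  · have hk : (kᴴ * M * k).map ((↑) : φ.range → B) =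
        ((k.map ((↑) : φ.range → B))ᴴ * M.map ((↑) : φ.range → B) *
          k.map ((↑) : φ.range → B)).map φ := by
      rw [coe_matrix_mul, coe_matrix_mul, hstar]
      ext i j
      rw [Matrix.map_apply, Matrix.map_apply, Matrix.mul_apply, Matrix.mul_apply, map_sum, map_sum]
      exact Finset.sum_congr rfl fun l _ => φ.isUCP.map_map_mul φ.idem (map_coe (k l j)) _
    rw [hk]
    exact φ.isUCP.map_pos (h.conj _)
  · have : (-d).map ((↑) : φ.range → B) = -d.map ((↑) : φ.range → B) := by ext; simp
    rw [this] at h2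
    have h3 := h1.eq_zero_of_neg h2
    dsimp only
    rw [h3]
    ext
    simp

end UCPProjection

namespace UCPMap

variable {S T U : OperatorSystem.{w}}

/-- The composition of unital completely positive maps. -/
def comp (ψ : UCPMap T U) (φ : UCPMap S T) : UCPMap S U where
  toLinearMap := ψ.toLinearMap ∘ₗ φ.toLinearMap
  map_unit := by
    rw [LinearMap.comp_apply, φ.map_unit, ψ.map_unit]
  map_pos n M hM := ψ.map_pos n _ (φ.map_pos n M hM)

theorem IsCompleteOrderIso.comp {ψ : UCPMap T U} {φ : UCPMap S T} (hψ : ψ.IsCompleteOrderIso)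
    (hφ : φ.IsCompleteOrderIso) : (ψ.comp φ).IsCompleteOrderIso :=
  ⟨hψ.1.comp hφ.1, fun n M h => hφ.2 n M (hψ.2 n _ h)⟩

/-- The inverse of a unital complete order isomorphism. -/
def IsCompleteOrderIso.symm {φ : UCPMap S T} (hφ : φ.IsCompleteOrderIso) : UCPMap T S where
  toLinearMap := (LinearEquiv.ofBijective φ.toLinearMap hφ.1).symm
  map_unit := by
    rw [LinearEquiv.coe_coe, LinearEquiv.symm_apply_eq]
    exact φ.map_unit.symm
  map_pos n M hM := hφ.2 n _ <| by
    convert hM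
    ext i j
    exact congrArg _ (LinearEquiv.apply_symm_apply (LinearEquiv.ofBijective φ.toLinearMap hφ.1) _)

theorem IsCompleteOrderIso.apply_symm {φ : UCPMap S T} (hφ : φ.IsCompleteOrderIso) (y : T) :
    φ (hφ.symm y) = y :=
  LinearEquiv.apply_symm_apply (LinearEquiv.ofBijective φ.toLinearMap hφ.1) y

theorem IsCompleteOrderIso.symm_apply {φ : UCPMap S T} (hφ : φ.IsCompleteOrderIso) (x : S) :
    hφ.symm (φ x) = x :=
  LinearEquiv.symm_apply_apply (LinearEquiv.ofBijective φ.toLinearMap hφ.1) x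

variable {B C : Type w} [CStarAlgebra B] [CStarAlgebra C]

/-- A unital completely positive map between C⋆-algebras, as a linear map between them. -/
def toCStarLinearMap (φ : UCPMap (.ofCStarAlgebra B) (.ofCStarAlgebra C)) : B →ₗ[ℂ] C :=
  (Submodule.subtype ⊤) ∘ₗ φ.toLinearMap ∘ₗ (Submodule.topEquiv (R := ℂ) (M := B)).symm

theorem isUCP (φ : UCPMap (.ofCStarAlgebra B) (.ofCStarAlgebra C)) : IsUCP φ.toCStarLinearMap where
  map_one := congrArg Subtype.val φ.map_unit
  map_pos {n M} hM := φ.map_pos n (M.map fun b => ⟨b, trivial⟩) hM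

end UCPMap

namespace OperatorSystem

variable {S : OperatorSystem.{w}}

/-- The Choi–Effros theorem: an operator system that is a retract of a C⋆-algebra is a
C⋆-algebra. -/
theorem isCStarProduct_of_retract {B : Type w} [CStarAlgebra B]
    (e : UCPMap S (ofCStarAlgebra B)) (θ : UCPMap (ofCStarAlgebra B) S) (h : ∀ x, θ (e x) = x) :
    S.IsCStarProduct fun x y => θ ⟨(e x : B) * (e y : B), trivial⟩ := by
  let φ : UCPProjection B :=
    { toLinearMap := (e.comp θ).toCStarLinearMap
      isUCP := (e.comp θ).isUCP
      idem := fun b => congrArg (fun x => (e x : B)) (h _) }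
  let e' : UCPMap S (ofCStarAlgebra φ.range) :=
    { toLinearMap :=
        { toFun := fun x => ⟨⟨e x, congrArg (fun x => (e x : B)) (h x)⟩, trivial⟩
          map_add' := fun x y => by ext; simp
          map_smul' := fun c x => by ext; simp }
      map_unit := Subtype.ext (Subtype.ext (congrArg Subtype.val e.map_unit :))
      map_pos := fun n M hM => (UCPProjection.matrixPos_iff _).2 (e.map_pos n M hM) }
  refine ⟨φ.range, inferInstance, e', ⟨⟨fun x y hxy => ?_, fun b => ?_⟩, fun n M hM => ?_⟩,
    fun x y => rfl⟩
  · rw [← h x, ← h y]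
    exact congrArg (fun z : ofCStarAlgebra φ.range => θ ⟨(z : φ.range), trivial⟩) hxy
  · exact ⟨θ ⟨(b : φ.range), trivial⟩, Subtype.ext (Subtype.ext (UCPProjection.map_coe b.1))⟩
  · have h1 := θ.map_pos n _ ((UCPProjection.matrixPos_iff _).1 hM :
      (ofCStarAlgebra B).Pos (M.map e))
    convert h1
    ext i j
    exact congrArg Subtype.val (h (M i j)).symm

/-- The multiplication is determined by the matrix order. -/
theorem IsCStarProduct.unique {m m' : S → S → S} (hm : S.IsCStarProduct m)
    (hm' : S.IsCStarProduct m') : m = m' := by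
  obtain ⟨M, _, e, he, hmul⟩ := hm
  obtain ⟨M', _, e', he', hmul'⟩ := hm'
  funext x y
  refine he'.1.1 (Subtype.ext ?_)
  have key := (e'.comp he.symm).isUCP.map_mul_of_leftInverse (e.comp he'.symm).isUCP
    (fun a => congrArg Subtype.val (show e (he'.symm (e' (he.symm ⟨a, trivial⟩))) = ⟨a, trivial⟩ by
      rw [he'.symm_apply, he.apply_symm]))
    (fun a => congrArg Subtype.val (show e' (he.symm (e (he'.symm ⟨a, trivial⟩))) = ⟨a, trivial⟩ by
      rw [he.symm_apply, he'.apply_symm])) (e x) (e y)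
  have hval : ∀ z : S, (e'.comp he.symm).toCStarLinearMap (e z : M) = (e' z : M') := fun z =>
    congrArg (fun z => (e' z : M')) (he.symm_apply z)
  rw [hmul', ← hval, hmul, key, hval, hval]

/-- A multiplication can be pulled back along a unital complete order isomorphism. -/
theorem IsCStarProduct.comap {T : OperatorSystem.{w}} {m : T → T → T} (hm : T.IsCStarProduct m)
    {φ : UCPMap S T} (hφ : φ.IsCompleteOrderIso) :
    S.IsCStarProduct fun x y => hφ.symm (m (φ x) (φ y)) := by
  obtain ⟨M, _, e, he, hmul⟩ := hm
  refine ⟨M, inferInstance, e.comp φ, he.comp hφ, fun x y => ?_⟩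
  exact (congrArg (fun z => (e z : M)) (hφ.apply_symm _)).trans (hmul _ _)

/-- Unital complete order isomorphisms are multiplicative. -/
theorem IsCStarProduct.map_mul {T : OperatorSystem.{w}} {m : S → S → S} {m' : T → T → T}
    (hm : S.IsCStarProduct m) (hm' : T.IsCStarProduct m') {φ : UCPMap S T}
    (hφ : φ.IsCompleteOrderIso) (x y : S) : φ (m x y) = m' (φ x) (φ y) := by
  rw [hm.unique (hm'.comap hφ), hφ.apply_symm]

end OperatorSystem

/-! ### Bounded families of C⋆-algebras -/

theorem norm_mul_self_le_norm_conjTranspose_mul_self {B : Type*} [CStarAlgebra B] {n : ℕ}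
    (N : Matrix (Fin n) (Fin n) B) (k l : Fin n) : ‖N k l‖ * ‖N k l‖ ≤ ‖(Nᴴ * N) l l‖ := by
  let _ := CStarAlgebra.spectralOrder B
  have := CStarAlgebra.spectralOrderedRing B
  rw [← CStarRing.norm_star_mul_self, Matrix.mul_apply]
  exact CStarAlgebra.norm_le_norm_of_nonneg_of_le (star_mul_self_nonneg _)
    (Finset.single_le_sum (f := fun j => Nᴴ l j * N j l)
      (fun j _ => star_mul_self_nonneg (N j l)) (Finset.mem_univ k))

section Linfty

variable {ι : Type u} {B : ι → Type w} [∀ i, CStarAlgebra (B i)]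

attribute [local instance] linftyCStarAlgebra

theorem matrixPos_linfty_iff {n : ℕ} (M : Matrix (Fin n) (Fin n) (lp B ∞)) :
    MatrixPos M ↔ ∀ i, MatrixPos (M.map fun f => f i) := by
  have hmul : ∀ (N : Matrix (Fin n) (Fin n) (lp B ∞)) (i : ι),
      (Nᴴ * N).map (fun f => f i) = (N.map fun f => f i)ᴴ * N.map fun f => f i := by
    intro N i
    ext k l
    simp only [Matrix.map_apply, Matrix.mul_apply, Matrix.conjTranspose_apply]
    rw [lp.coeFn_sum, Finset.sum_apply]
    rfl
  constructor
  · rintro ⟨N, rfl⟩ i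
    exact ⟨_, hmul N i⟩
  · intro h
    choose N hN using h
    -- The column norms of `N i` are controlled by the diagonal of `M`, so `N` is bounded in `i`.
    have hb : ∀ k l, Memℓp (fun i => N i k l) ∞ := fun k l => by
      refine memℓp_infty ⟨√‖M l l‖, ?_⟩
      rintro _ ⟨i, rfl⟩
      refine Real.le_sqrt_of_sq_le ?_
      rw [sq]
      refine (norm_mul_self_le_norm_conjTranspose_mul_self (N i) k l).trans ?_
      rw [← hN]
      exact lp.norm_apply_le_norm ENNReal.top_ne_zero (M l l) i
    refine ⟨.of fun k l => ⟨_, hb k l⟩, ?_⟩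
    ext k l i
    exact (congrFun (congrFun (hN i) k) l).trans
      (congrFun (congrFun (hmul (.of fun k l => ⟨_, hb k l⟩) i) k) l).symm

end Linfty

namespace UCPMap

variable {S T : OperatorSystem.{w}}

/-- The identity map. -/
def id (S : OperatorSystem.{w}) : UCPMap S S := ⟨LinearMap.id, rfl, fun _ _ h => h⟩

/-- The inclusion into the surrounding C⋆-algebra. -/
def incl (S : OperatorSystem.{w}) : UCPMap S (.ofCStarAlgebra S.ambient) where
  toLinearMap := (Submodule.topEquiv (R := ℂ)).symm.toLinearMap ∘ₗ S.space.subtype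
  map_unit := rfl
  map_pos _ _ h := h

/-- Restriction of the codomain of a map into the surrounding C⋆-algebra. -/
def codRestrict (φ : UCPMap S (.ofCStarAlgebra T.ambient))
    (h : ∀ x, (φ x : T.ambient) ∈ T.space) : UCPMap S T where
  toLinearMap := (Submodule.subtype ⊤ ∘ₗ φ.toLinearMap).codRestrict T.space h
  map_unit := Subtype.ext (congrArg Subtype.val φ.map_unit :)
  map_pos n M hM := φ.map_pos n M hM

theorem isCompleteOrderEmbedding_of_leftInverse {φ : UCPMap S T} (ψ : UCPMap T S)
    (h : ∀ x, ψ (φ x) = x) : φ.IsCompleteOrderEmbedding := fun n M hM => by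
  convert ψ.map_pos n _ hM
  ext i j
  exact congrArg Subtype.val (h (M i j)).symm

theorem isCompleteOrderIso_of_inverse {φ : UCPMap S T} (ψ : UCPMap T S)
    (h : ∀ x, ψ (φ x) = x) (h' : ∀ y, φ (ψ y) = y) : φ.IsCompleteOrderIso :=
  ⟨⟨Function.LeftInverse.injective (g := ψ) h, fun y => ⟨ψ y, h' y⟩⟩,
    isCompleteOrderEmbedding_of_leftInverse ψ h⟩

section Linfty

variable {ι : Type u} {B : ι → Type (max u w)} [∀ i, CStarAlgebra (B i)]
  {S : OperatorSystem.{max u w}}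

attribute [local instance] linftyCStarAlgebra

variable (B) in
/-- The evaluation at an index. -/
def linftyEval (i : ι) : UCPMap (.ofCStarAlgebra (lp B ∞)) (.ofCStarAlgebra (B i)) where
  toLinearMap :=
    { toFun := fun f => ⟨(f : lp B ∞) i, trivial⟩
      map_add' := fun _ _ => rfl
      map_smul' := fun _ _ => rfl }
  map_unit := rfl
  map_pos _ M hM := (matrixPos_linfty_iff (M.map Subtype.val)).1 hM i

/-- The unital completely positive map into the `ℓ^∞`-direct sum with given components. -/
def linftyLift (φ : ∀ i, UCPMap S (.ofCStarAlgebra (B i))) :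
    UCPMap S (.ofCStarAlgebra (lp B ∞)) where
  toLinearMap :=
    { toFun := fun x => ⟨⟨fun i => φ i x, memℓp_infty
        ⟨6 * ‖x‖, by rintro _ ⟨i, rfl⟩; exact (φ i).norm_map_le x⟩⟩, trivial⟩
      map_add' := fun x y => Subtype.ext <| lp.ext <| funext fun i =>
        congrArg Subtype.val (map_add (φ i).toLinearMap x y)
      map_smul' := fun c x => Subtype.ext <| lp.ext <| funext fun i =>
        congrArg Subtype.val (map_smul (φ i).toLinearMap c x) }
  map_unit := Subtype.ext <| lp.ext <| funext fun i => congrArg Subtype.val (φ i).map_unit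
  map_pos n M hM := (matrixPos_linfty_iff _).2 fun i => (φ i).map_pos n M hM

theorem pos_of_linftyLift_pos (φ : ∀ i, UCPMap S (.ofCStarAlgebra (B i))) {n : ℕ}
    {M : Matrix (Fin n) (Fin n) S}
    (h : (OperatorSystem.ofCStarAlgebra (lp B ∞)).Pos (M.map (linftyLift φ))) (i : ι) :
    (OperatorSystem.ofCStarAlgebra (B i)).Pos (M.map (φ i)) :=
  (matrixPos_linfty_iff _).1 h i

end Linfty

end UCPMap

/-! ### Injective groupoid dynamical systems -/

namespace GroupoidDynamicalSystem

variable {G₀ : Type u} [Groupoid.{v} G₀]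

attribute [local instance] linftyCStarAlgebra

section Regular

variable (𝒜 : GroupoidDynamicalSystem.{u, v, max u v w} G₀)

/-- The C⋆-algebras surrounding the fibres of `𝒜` at the ranges of the arrows out of `x`. -/
abbrev regularFamily (x : G₀) (p : Σ y, x ⟶ y) : Type (max u v w) := (𝒜.fiber p.1).ambient

/-- Translation by `h`, taking a bounded function `F` of the arrows out of `x` to the function
`g ↦ F(gh)` of the arrows out of `y`. -/
def translation {x y : G₀} (h : x ⟶ y) :
    UCPMap (.ofCStarAlgebra (lp (𝒜.regularFamily x) ∞))
      (.ofCStarAlgebra (lp (𝒜.regularFamily y) ∞)) :=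
  UCPMap.linftyLift.{max u v, w} fun p =>
    UCPMap.linftyEval.{max u v, w} (𝒜.regularFamily x) ⟨p.1, h ≫ p.2⟩

theorem translation_comp {x y z : G₀} (g : y ⟶ z) (h : x ⟶ y)
    (F : OperatorSystem.ofCStarAlgebra (lp (𝒜.regularFamily x) ∞)) :
    𝒜.translation g (𝒜.translation h F) = 𝒜.translation (h ≫ g) F := by
  refine Subtype.ext <| lp.ext <| funext fun p => ?_
  change F.1 ⟨p.1, h ≫ g ≫ p.2⟩ = F.1 ⟨p.1, (h ≫ g) ≫ p.2⟩
  rw [Category.assoc]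

theorem translation_id {x : G₀}
    (F : OperatorSystem.ofCStarAlgebra (lp (𝒜.regularFamily x) ∞)) :
    𝒜.translation (𝟙 x) F = F := by
  refine Subtype.ext <| lp.ext <| funext fun p => ?_
  change F.1 ⟨p.1, 𝟙 x ≫ p.2⟩ = F.1 ⟨p.1, p.2⟩
  rw [Category.id_comp]

/-- The groupoid acting by translation on the C⋆-algebras of bounded functions on the arrows
out of a unit. -/
def regular : GroupoidDynamicalSystem.{u, v, max u v w} G₀ where
  fiber x := .ofCStarAlgebra (lp (𝒜.regularFamily x) ∞)
  action := 𝒜.translation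
  action_iso g := UCPMap.isCompleteOrderIso_of_inverse (𝒜.translation (Groupoid.inv g))
    (fun F => by rw [translation_comp, Groupoid.comp_inv, translation_id])
    (fun F => by rw [translation_comp, Groupoid.inv_comp, translation_id])
  action_comp := 𝒜.translation_comp

/-- The orbit maps `a ↦ (g ↦ α_g(a))`. -/
def toRegular : Morphism 𝒜 𝒜.regular where
  app _ := UCPMap.linftyLift.{max u v, w} fun p => (UCPMap.incl (𝒜.fiber p.1)).comp (𝒜.action p.2)
  equivariant g a := Subtype.ext <| lp.ext <| funext fun p =>
    (congrArg Subtype.val (𝒜.action_comp p.2 g a).symm :)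

/-- The component of the orbit map at the identity arrow already detects positivity. -/
theorem toRegular_isEmbedding : 𝒜.toRegular.IsEmbedding := fun x n M hM =>
  (𝒜.action_iso (𝟙 x)).2 n M (UCPMap.pos_of_linftyLift_pos.{max u v, w}
    (fun p : Σ y, x ⟶ y => (UCPMap.incl (𝒜.fiber p.1)).comp (𝒜.action p.2)) hM ⟨x, 𝟙 x⟩)

/-- The identity morphism. -/
def Morphism.id : Morphism 𝒜 𝒜 := ⟨fun x => UCPMap.id (𝒜.fiber x), fun _ _ => rfl⟩

variable {𝒜}

/-- The fibres of an injective system are retracts of C⋆-algebras. -/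
theorem IsInjective.exists_isCStarProduct (h𝒜 : 𝒜.IsInjective) (x : G₀) :
    ∃ m, (𝒜.fiber x).IsCStarProduct m := by
  obtain ⟨Θ, hΘ⟩ := h𝒜 𝒜 𝒜.regular 𝒜.toRegular 𝒜.toRegular_isEmbedding (Morphism.id 𝒜)
  exact ⟨_, OperatorSystem.isCStarProduct_of_retract (𝒜.toRegular.app x) (Θ.app x) (hΘ x)⟩

end Regular

section FixedPoints

variable {𝒜 : GroupoidDynamicalSystem.{u, v, max u v w} G₀}

theorem fixedPoints.ext {f f' : 𝒜.fixedPoints}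
    (h : ∀ x, fixedPoints.eval f x = fixedPoints.eval f' x) : f = f' :=
  Subtype.ext <| lp.ext <| funext fun x => congrArg Subtype.val (h x)

theorem fixedPoints.action_eval (f : 𝒜.fixedPoints) {x y : G₀} (g : x ⟶ y) :
    𝒜.action g (fixedPoints.eval f x) = fixedPoints.eval f y :=
  (f.2.choose_spec x y g).symm

theorem fixedPoints.pos_iff {n : ℕ} (M : Matrix (Fin n) (Fin n) 𝒜.fixedPoints) :
    𝒜.fixedPoints.Pos M ↔ ∀ x, (𝒜.fiber x).Pos (M.map fun f => fixedPoints.eval f x) :=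
  matrixPos_linfty_iff (B := fun x => (𝒜.fiber x).ambient)
    (M.map fun f : 𝒜.fixedPoints => (f : 𝒜.fixedPoints.ambient))

/-- The evaluation of fixed points at a unit. -/
def fixedPoints.evalMap (𝒜 : GroupoidDynamicalSystem.{u, v, max u v w} G₀) (x : G₀) :
    UCPMap 𝒜.fixedPoints (𝒜.fiber x) where
  toLinearMap :=
    { toFun := fun f => fixedPoints.eval f x
      map_add' := fun _ _ => rfl
      map_smul' := fun _ _ => rfl }
  map_unit := rfl
  map_pos _ M hM := (fixedPoints.pos_iff M).1 hM x

/-- A compatible family of unital completely positive maps into the fibres, as a map into the fixed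
points. -/
def fixedPoints.lift {S : OperatorSystem.{max u v w}} (φ : ∀ x, UCPMap S (𝒜.fiber x))
    (h : ∀ {x y : G₀} (g : x ⟶ y) (a : S), 𝒜.action g (φ x a) = φ y a) :
    UCPMap S 𝒜.fixedPoints :=
  UCPMap.codRestrict (T := 𝒜.fixedPoints)
    (UCPMap.linftyLift.{u, max v w} fun x => (UCPMap.incl (𝒜.fiber x)).comp (φ x))
    fun a => ⟨fun x => (φ x a).2, fun _ _ g => (h g a).symm⟩

variable (G₀) in
/-- The trivial action on a constant family. -/
def constant (S : OperatorSystem.{max u v w}) : GroupoidDynamicalSystem.{u, v, max u v w} G₀ where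
  fiber _ := S
  action _ := UCPMap.id S
  action_iso _ := UCPMap.isCompleteOrderIso_of_inverse (UCPMap.id S) (fun _ => rfl) fun _ => rfl
  action_comp _ _ _ := rfl

/-- A map into the fixed points is a morphism from a trivial action, so that extension problems for
such maps are extension problems for morphisms. -/
theorem IsInjective.fixedPoints (h𝒜 : 𝒜.IsInjective) : 𝒜.fixedPoints.IsInjective := by
  intro S T φ hφ ψ
  obtain ⟨Θ, hΘ⟩ := h𝒜 (constant G₀ S) (constant G₀ T) ⟨fun _ => φ, fun _ _ => rfl⟩ (fun _ => hφ)
    ⟨fun x => (fixedPoints.evalMap 𝒜 x).comp ψ, fun g a => fixedPoints.action_eval (ψ a) g⟩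
  exact ⟨fixedPoints.lift Θ.app Θ.equivariant, fun a => fixedPoints.ext fun x => hΘ x a⟩

/-- The pointwise product of fixed points is a C⋆-algebra product: the retraction of the
`ℓ^∞`-direct sum of the fibres onto the fixed points sends the product of two fixed points to
itself, so that the Choi–Effros product is the pointwise one. -/
theorem IsInjective.exists_isCStarProduct_fixedPoints (h𝒜 : 𝒜.IsInjective)
    (m : ∀ x : G₀, 𝒜.fiber x → 𝒜.fiber x → 𝒜.fiber x)
    (hm : ∀ x, (𝒜.fiber x).IsCStarProduct (m x)) :
    ∃ p : 𝒜.fixedPoints → 𝒜.fixedPoints → 𝒜.fixedPoints,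
      (∀ (f f' : 𝒜.fixedPoints) (x : G₀),
        fixedPoints.eval (p f f') x = m x (fixedPoints.eval f x) (fixedPoints.eval f' x)) ∧
      𝒜.fixedPoints.IsCStarProduct p := by
  have hm' := hm
  choose M _ e he hmul using hm'
  let E : UCPMap 𝒜.fixedPoints (.ofCStarAlgebra (lp M ∞)) :=
    UCPMap.linftyLift.{u, max v w} fun x => (e x).comp (fixedPoints.evalMap 𝒜 x)
  have hE : E.IsCompleteOrderEmbedding := fun n N hN => (fixedPoints.pos_iff N).2 fun x =>
    (he x).2 n _ (UCPMap.pos_of_linftyLift_pos.{u, max v w}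
      (fun x => (e x).comp (fixedPoints.evalMap 𝒜 x)) hN x)
  obtain ⟨θ, hθ⟩ := h𝒜.fixedPoints _ _ E hE (UCPMap.id _)
  refine ⟨_, fun f f' x => ?_, OperatorSystem.isCStarProduct_of_retract E θ hθ⟩
  let F : OperatorSystem.ofCStarAlgebra (lp M ∞) := ⟨(E f).1 * (E f').1, trivial⟩
  have hF : ∀ x, (he x).symm (UCPMap.linftyEval.{u, max v w} M x F) =
      m x (fixedPoints.eval f x) (fixedPoints.eval f' x) := fun x => by
    rw [← (he x).symm_apply (m x _ _)]
    exact congrArg (he x).symm (Subtype.ext (hmul x _ _).symm)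
  -- The pointwise product as a bounded section; boundedness comes from that of `F`.
  let R : UCPMap (.ofCStarAlgebra (lp M ∞))
      (.ofCStarAlgebra (lp (fun x => (𝒜.fiber x).ambient) ∞)) :=
    UCPMap.linftyLift.{u, max v w} fun x =>
      (UCPMap.incl (𝒜.fiber x)).comp ((he x).symm.comp (UCPMap.linftyEval.{u, max v w} M x))
  let q : 𝒜.fixedPoints := ⟨(R F).1,
    fun x => ((he x).symm (UCPMap.linftyEval.{u, max v w} M x F)).2,
    fun x y g => by
      change (he y).symm (UCPMap.linftyEval.{u, max v w} M y F) =
        𝒜.action g ((he x).symm (UCPMap.linftyEval.{u, max v w} M x F))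
      rw [hF, hF, (hm x).map_mul (hm y) (𝒜.action_iso g), fixedPoints.action_eval,
        fixedPoints.action_eval]⟩
  have hq : ∀ x, fixedPoints.eval q x = m x (fixedPoints.eval f x) (fixedPoints.eval f' x) := hF
  have hEq : E q = F := Subtype.ext <| lp.ext <| funext fun x =>
    (congrArg (fun a => (e x a : M x)) (hq x)).trans (hmul x _ _)
  rw [← hq]
  exact congrArg (fun f => fixedPoints.eval f x) ((congrArg θ hEq).symm.trans (hθ q))

end FixedPoints

end GroupoidDynamicalSystem

end

theorem mainTheorem6 {G₀ : Type u} [Groupoid.{v} G₀]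
    (𝒜 : GroupoidDynamicalSystem.{u, v, max u v w} G₀) (h𝒜 : 𝒜.IsInjective) :
    -- the fibres carry unique multiplications making them C⋆-algebras
    (∃! m : ∀ x : G₀, 𝒜.fiber x → 𝒜.fiber x → 𝒜.fiber x,
      ∀ x, (𝒜.fiber x).IsCStarProduct (m x)) ∧
    -- and with these multiplications
    ∀ m : ∀ x : G₀, 𝒜.fiber x → 𝒜.fiber x → 𝒜.fiber x,
      (∀ x, (𝒜.fiber x).IsCStarProduct (m x)) →
      -- the maps `α_g` are multiplicative,
      (∀ (x y : G₀) (g : x ⟶ y) (a b : 𝒜.fiber x),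
        𝒜.action g (m x a b) = m y (𝒜.action g a) (𝒜.action g b)) ∧
      -- the fixed points are a C⋆-algebra under pointwise multiplication,
      (∃ p : 𝒜.fixedPoints → 𝒜.fixedPoints → 𝒜.fixedPoints,
        (∀ (f f' : 𝒜.fixedPoints) (x : G₀),
          GroupoidDynamicalSystem.fixedPoints.eval (p f f') x =
            m x (GroupoidDynamicalSystem.fixedPoints.eval f x)
              (GroupoidDynamicalSystem.fixedPoints.eval f' x)) ∧
        𝒜.fixedPoints.IsCStarProduct p) ∧
      -- which is injective
      𝒜.fixedPoints.IsInjective := by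
  choose m hm using h𝒜.exists_isCStarProduct
  refine ⟨⟨m, hm, fun m' hm' => funext fun x => (hm' x).unique (hm x)⟩, fun m hm => ⟨?_, ?_, ?_⟩⟩
  · exact fun x y g a b => (hm x).map_mul (hm y) (𝒜.action_iso g) a b
  · exact h𝒜.exists_isCStarProduct_fixedPoints m hm
  · exact h𝒜.fixedPoints
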